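/- Let $\mathcal L$ be a positive-definite linear functional on $\mathbb C[z]$ (that is, $\mathcal L[p]>0$ for every nonzero polynomial $p$ that is non-negative on $\mathbb R$), and let $\{P_n\}_{n\ge 0}$ be its monic orthogonal polynomial system: $P_n$ is monic of degree $n$, $\mathcal L[P_nP_m]=0$ for $n\neq m$, and $\mathcal L[P_n^2]\ne 0$. Suppose that $\{P_n\}$ is in a Nevai class $\mathcal N(a,c)$ with $a\in[0,\infty)$ and $c\in\mathbb R$, i.e. the coefficients of the recurrence $P_0=1$, $P_1(z)=z-c_1$, $P_n(z)=(z-c_n)P_{n-1}(z)-\lambda_nP_{n-2}(z)$ $(n\ge 2)$ satisfy $c_n\to c$ and $\lambda_n\to a$. Let $\kappa\in\mathbb C\setminus\mathbb R$ and $s_0^*\in\mathbb R\setminus\{0\}$. Put $$Q_n(z)=\mathcal L_y\!\left[\frac{P_n(z)-P_n(y)}{z-y}\right],\qquad R_n(z)=P_n(z)+\frac1{s_0^*}Q_n(z),$$ and let $P^{-*}_0=P_0$ and $$P_n^{-*}(\kappa,z)=P_n(z)-\frac{R_n(\kappa)}{R_{n-1}(\kappa)}P_{n-1}(z),\qquad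 n\ge 1,$$ be the Geronimus transformation of $\{P_n\}$ at $\kappa$. It is well defined: $R_n(\kappa)\neq0$ for all $n\ge 0$, and $\{P^{-*}_n(\kappa,\cdot)\}_{n\ge0}$ is the monic orthogonal polynomial system of the linear functional $\mathcal L^{-*}$ determined by $\mathcal L^{-*}[(z-\kappa)p(z)]=\mathcal L[p(z)]$ for all polynomials $p$ and $\mathcal L^{-*}[1]=s_0^*$. Moreover, there is a sequence $\{\xi_n\}_{n\ge1}$ such that $\xi_n$ is a zero of $P_n^{-*}(\kappa,\cdot)$ for every $n\ge 1$ and $\xi_n\to\kappa$, while the imaginary parts of the remaining zeros of $P_n^{-*}(\kappa,\cdot)$ tend to zero: for every $\varepsilon>0$ there is an $N$ such that for all $n\ge N$ every zero $w$ of $P_n^{-*}(\kappa,\cdot)$ other than $\xi_n$ (zeros counted with multiplicity, one copy of $\xi_n$ removed) satisfies $|\operatorname{Im} w|<\varepsilon$. -/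

import Mathlib

open Polynomial Filter Topology

/-- The linear functional `L` on complex polynomials is positive-definite: `L[p]` is real and
positive for every nonzero (real) polynomial `p` that is non-negative on the real line. -/
def IsPositiveDefinite (L : ℂ[X] →ₗ[ℂ] ℂ) : Prop :=
  ∀ p : ℝ[X], p ≠ 0 → (∀ x : ℝ, 0 ≤ p.eval x) →
    0 < (L (p.map Complex.ofRealHom)).re ∧ (L (p.map Complex.ofRealHom)).im = 0

/-- `P` is the monic orthogonal polynomial system of the linear functional `L`. -/
structure IsMonicOPS (L : ℂ[X] →ₗ[ℂ] ℂ) (P : ℕ → ℂ[X]) : Prop where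
  monic : ∀ n, (P n).Monic
  natDegree_eq : ∀ n, (P n).natDegree = n
  orthogonal : ∀ n m, n ≠ m → L (P n * P m) = 0
  sq_ne_zero : ∀ n, L (P n ^ 2) ≠ 0

/-- The monic polynomials `P` are in the Nevai class `N(a, c)`, with `a ≥ 0`: the coefficients of
their three-term recurrence `P₁ = z - c₁`, `Pₙ = (z - cₙ) Pₙ₋₁ - λₙ Pₙ₋₂` (`n ≥ 2`) satisfy
`cₙ → c` and `λₙ → a`. -/
def InNevaiClass (P : ℕ → ℂ[X]) (a c : ℝ) : Prop :=
  0 ≤ a ∧ ∃ cs lam : ℕ → ℂ,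
    P 0 = 1 ∧ P 1 = X - C (cs 1) ∧
    (∀ n, 2 ≤ n → P n = (X - C (cs n)) * P (n - 1) - C (lam n) * P (n - 2)) ∧
    Tendsto cs atTop (𝓝 (c : ℂ)) ∧ Tendsto lam atTop (𝓝 (a : ℂ))

/-- The polynomial `(p(y) - p(z)) / (y - z)` in the variable `y`, for a fixed number `z`. -/
noncomputable def dividedDifference (p : ℂ[X]) (z : ℂ) : ℂ[X] :=
  (p - C (p.eval z)) /ₘ (X - C z)

theorem mul_dividedDifference (p : ℂ[X]) (z : ℂ) :
    (X - C z) * dividedDifference p z = p - C (p.eval z) := by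
  rw [dividedDifference, mul_divByMonic_eq_iff_isRoot]
  simp

theorem eq_dividedDifference {p q : ℂ[X]} {z : ℂ} (h : (X - C z) * q = p - C (p.eval z)) :
    q = dividedDifference p z :=
  mul_left_cancel₀ (X_sub_C_ne_zero z) (h.trans (mul_dividedDifference p z).symm)

/-- The values at `z` of the polynomials of the second kind,
`Qₙ(z) = L_y[(Pₙ(z) - Pₙ(y)) / (z - y)]`. -/
noncomputable def secondKind (L : ℂ[X] →ₗ[ℂ] ℂ) (P : ℕ → ℂ[X]) (n : ℕ) (z : ℂ) : ℂ :=
  L (dividedDifference (P n) z)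

/-- `Rₙ(z) = Pₙ(z) + Qₙ(z) / s`. -/
noncomputable def geronimusR (L : ℂ[X] →ₗ[ℂ] ℂ) (P : ℕ → ℂ[X]) (s : ℂ) (n : ℕ) (z : ℂ) : ℂ :=
  (P n).eval z + 1 / s * secondKind L P n z

/-- The Geronimus transformation at `κ` of the functional `L`, with value `s` at `1`:
`p ↦ L[(p(z) - p(κ)) / (z - κ)] + s p(κ)`. -/
noncomputable def geronimusFunctional (L : ℂ[X] →ₗ[ℂ] ℂ) (κ s : ℂ) : ℂ[X] →ₗ[ℂ] ℂ where
  toFun p := L (dividedDifference p κ) + s * p.eval κ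
  map_add' p q := by
    have h : dividedDifference p κ + dividedDifference q κ = dividedDifference (p + q) κ := by
      apply eq_dividedDifference
      rw [mul_add, mul_dividedDifference, mul_dividedDifference, eval_add, C_add]
      ring
    rw [← h, map_add, eval_add]
    ring
  map_smul' a p := by
    have h : a • dividedDifference p κ = dividedDifference (a • p) κ := by
      apply eq_dividedDifference
      rw [mul_smul_comm, mul_dividedDifference, smul_sub, eval_smul, smul_C]
    rw [← h, map_smul, eval_smul]
    simp only [smul_eq_mul, RingHom.id_apply]
    ring

/-- The Christoffel transformation at `κ` of the Geronimus transformation of `L` is `L`. -/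
theorem geronimusFunctional_mul (L : ℂ[X] →ₗ[ℂ] ℂ) (κ s : ℂ) (p : ℂ[X]) :
    geronimusFunctional L κ s ((X - C κ) * p) = L p := by
  have h : p = dividedDifference ((X - C κ) * p) κ := eq_dividedDifference (by simp)
  change L (dividedDifference ((X - C κ) * p) κ) + s * ((X - C κ) * p).eval κ = L p
  rw [← h]
  simp

theorem geronimusFunctional_one (L : ℂ[X] →ₗ[ℂ] ℂ) (κ s : ℂ) :
    geronimusFunctional L κ s 1 = s := by
  have h : (0 : ℂ[X]) = dividedDifference 1 κ := eq_dividedDifference (by simp)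
  change L (dividedDifference 1 κ) + s * (1 : ℂ[X]).eval κ = s
  rw [← h]
  simp

/-- The Geronimus transformation at `κ` of the polynomials `P`: `P₀⁻* = P₀` and
`Pₙ⁻*(κ, z) = Pₙ(z) + Aₙ Pₙ₋₁(z)` with `Aₙ = - Rₙ(κ) / Rₙ₋₁(κ)` for `n ≥ 1`. -/
noncomputable def geronimusPoly (L : ℂ[X] →ₗ[ℂ] ℂ) (P : ℕ → ℂ[X]) (κ s : ℂ) : ℕ → ℂ[X]
  | 0 => P 0
  | n + 1 => P (n + 1) + C (-(geronimusR L P s (n + 1) κ / geronimusR L P s n κ)) * P n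

/-!
The ratios `pₙ(z) = Pₙ₊₁(z) / Pₙ(z)` satisfy `pₙ = z - b - lam / pₙ₋₁` with real coefficients and
`lam ≥ 0` (`IsMonicOPS.real_recurrence`), so they map the upper half-plane to itself and do not
decrease the imaginary part. The numbers `rₙ = Rₙ₊₁(κ) / Rₙ(κ)` obey the same recurrence at `z = κ`
with only the first coefficient changed, by a real amount (`geronimusR_succ`). In particular
`Rₙ(κ) ≠ 0`, and the orthogonality of the transformed system is then an algebraic computation
(`isMonicOPS_geronimus`).

The non-real zeros of the transformed polynomial of degree `n + 1` are the solutions of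
`pₙ(w) = rₙ`. For `Im z > 0` the map `w ↦ z - c - a / w` has an attracting fixed point `r(z)` in the
upper half-plane, and a repelling fixed point `a / r(z)` outside it. In the coordinate which sends
them to `0` and `∞` the recurrence is an asymptotically linear contraction, so `pₙ(z) → r(z)`
locally uniformly (`tendsto_recurrenceRatio`), and `rₙ → r(κ)` for the same reason. The divided
differences of `pₙ` also satisfy a contracting linear recurrence, and converge near `κ` to
`1 / (1 - a / r(κ)²) ≠ 0` (`tendsto_ratioSlope`). Thus `pₙ` is injective on a fixed disc about `κ`,
with a uniform lower bound on its difference quotients. This bound yields a solution of `pₙ(w) = rₙ`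
close to `κ` by the open mapping theorem (`eventually_exists_recurrenceRatio_eq`), shows that it is
the only one in the disc, and shows that it is a simple zero. All other solutions with `Im w ≥ ε`
lie in a compact set; they are excluded for large `n` because `z = c + r(z) + a / r(z)` is
determined by `r(z)` (`eventually_mem_ball_of_recurrenceRatio_eq`). There are no zeros in the lower
half-plane when `Im κ > 0`, and the case `Im κ < 0` follows by complex conjugation.
-/

/-! ### Perturbed contractions -/

/-- A family of non-negative sequences with `x (n + 1) i ≤ g * x n i + h`, where `g → q < 1` and
`h → 0` as `n → ∞` and `i` runs along `l`, tends to zero jointly in `n` and `i`. -/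
theorem tendsto_zero_of_le_mul_add {ι : Type*} {l : Filter ι} {x : ℕ → ι → ℝ} {g h : ℕ × ι → ℝ}
    {q : ℝ} (hx : ∀ n i, 0 ≤ x n i) (hq : q < 1)
    (hg : Tendsto g (atTop ×ˢ l) (𝓝 q)) (hh : Tendsto h (atTop ×ˢ l) (𝓝 0))
    (hb : ∀ n, ∃ B, ∀ᶠ i in l, x n i ≤ B)
    (hstep : ∀ᶠ y : ℕ × ι in atTop ×ˢ l, x (y.1 + 1) y.2 ≤ g y * x y.1 y.2 + h y) :
    Tendsto (fun y : ℕ × ι => x y.1 y.2) (atTop ×ˢ l) (𝓝 0) := by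
  obtain ⟨q', hq'0, hq'1⟩ : ∃ q', max q 0 < q' ∧ q' < 1 := exists_between (by simp [hq])
  have hqq : q < q' := (le_max_left _ _).trans_lt hq'0
  have hq0 : 0 < q' := (le_max_right _ _).trans_lt hq'0
  rw [Metric.tendsto_nhds]
  intro η hη
  have h1 : ∀ᶠ y in atTop ×ˢ l, g y < q' := hg.eventually (gt_mem_nhds hqq)
  have h2 : ∀ᶠ y in atTop ×ˢ l, h y < η / 2 * (1 - q') :=
    hh.eventually (gt_mem_nhds (by have : 0 < 1 - q' := by linarith
                                   positivity))
  obtain ⟨pa, hpa, pb, hpb, hall⟩ := eventually_prod_iff.1 ((h1.and h2).and hstep)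
  obtain ⟨N, hN⟩ := eventually_atTop.1 hpa
  obtain ⟨B, hB⟩ := hb N
  have hind : ∀ i, pb i → x N i ≤ B → ∀ k, x (N + k) i ≤ q' ^ k * B + η / 2 := by
    intro i hi hiB k
    induction k with
    | zero => simpa using hiB.trans (by linarith)
    | succ k ih =>
      obtain ⟨⟨hg', hh'⟩, hs⟩ := hall (hN (N + k) (by omega)) hi
      have := mul_le_mul_of_nonneg_right hg'.le (hx (N + k) i)
      have := mul_le_mul_of_nonneg_left ih hq0.le
      simp only [] at hs
      calc x (N + (k + 1)) i ≤ _ := hs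
        _ ≤ q' * (q' ^ k * B + η / 2) + η / 2 * (1 - q') := by linarith
        _ = _ := by ring
  have hlim : Tendsto (fun k => q' ^ k * B) atTop (𝓝 0) := by
    simpa using (tendsto_pow_atTop_nhds_zero_of_lt_one hq0.le hq'1).mul_const B
  obtain ⟨K, hK⟩ := eventually_atTop.1 (hlim.eventually (gt_mem_nhds (half_pos hη)))
  refine eventually_prod_iff.2 ⟨fun n => N + K ≤ n, eventually_ge_atTop _,
    fun i => pb i ∧ x N i ≤ B, hpb.and hB, ?_⟩
  intro n hn i hi
  obtain ⟨k, rfl⟩ : ∃ k, n = N + k := ⟨n - N, by omega⟩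
  have := hind i hi.1 hi.2 k
  have := hK k (by omega)
  simp only [dist_zero_right, Real.norm_eq_abs, abs_of_nonneg (hx _ _)]
  linarith

/-! ### Ratios of consecutive orthogonal polynomials -/

/-- The finite continued fraction `z - b₀`, `z - b₁ - lam₁ / (z - b₀)`, and so on: the ratio at `z`
of the polynomials of degrees `n + 1` and `n` in a three-term recurrence with coefficients
`b` and `lam`. -/
noncomputable def recurrenceRatio (b lam : ℕ → ℝ) : ℕ → ℂ → ℂ
  | 0, z => z - b 0
  | n + 1, z => z - b (n + 1) - lam (n + 1) / recurrenceRatio b lam n z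

section
variable {b lam : ℕ → ℝ}

theorem Complex.im_ofReal_div (x : ℝ) (w : ℂ) : ((x : ℂ) / w).im = -(x * w.im / ‖w‖ ^ 2) := by
  rw [Complex.div_im, Complex.sq_norm]
  simp

theorem im_le_im_recurrenceRatio (hlam : ∀ n, 0 ≤ lam n) {z : ℂ} (hz : 0 < z.im) (n : ℕ) :
    z.im ≤ (recurrenceRatio b lam n z).im := by
  induction n with
  | zero => simp [recurrenceRatio]
  | succ n ih =>
    have : 0 ≤ lam (n + 1) * (recurrenceRatio b lam n z).im / ‖recurrenceRatio b lam n z‖ ^ 2 := by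
      have := hlam (n + 1)
      have : 0 ≤ (recurrenceRatio b lam n z).im := hz.le.trans ih
      positivity
    simp only [recurrenceRatio, Complex.sub_im, Complex.ofReal_im, Complex.im_ofReal_div]
    linarith

theorem im_le_norm_recurrenceRatio (hlam : ∀ n, 0 ≤ lam n) {z : ℂ} (hz : 0 < z.im) (n : ℕ) :
    z.im ≤ ‖recurrenceRatio b lam n z‖ :=
  (im_le_im_recurrenceRatio hlam hz n).trans ((le_abs_self _).trans (Complex.abs_im_le_norm _))

theorem recurrenceRatio_conj (n : ℕ) (z : ℂ) :
    recurrenceRatio b lam n (starRingEnd ℂ z) = starRingEnd ℂ (recurrenceRatio b lam n z) := by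
  induction n with
  | zero => simp [recurrenceRatio]
  | succ n ih => simp [recurrenceRatio, ih]

theorem recurrenceRatio_ne_zero (hlam : ∀ n, 0 ≤ lam n) {z : ℂ} (hz : z.im ≠ 0) (n : ℕ) :
    recurrenceRatio b lam n z ≠ 0 := by
  rcases hz.lt_or_gt with h | h
  · have h' : 0 < (starRingEnd ℂ z).im := by simpa using h
    have := im_le_norm_recurrenceRatio (b := b) hlam h' n
    rw [recurrenceRatio_conj, RCLike.norm_conj] at this
    exact norm_pos_iff.1 (h'.trans_le this)
  · exact norm_pos_iff.1 (h.trans_le (im_le_norm_recurrenceRatio hlam h n))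

theorem differentiableAt_recurrenceRatio (hlam : ∀ n, 0 ≤ lam n) {z : ℂ} (hz : z.im ≠ 0) (n : ℕ) :
    DifferentiableAt ℂ (recurrenceRatio b lam n) z := by
  induction n with
  | zero =>
    change DifferentiableAt ℂ (fun z => z - (b 0 : ℂ)) z
    fun_prop
  | succ n ih =>
    change DifferentiableAt ℂ
      (fun z => z - (b (n + 1) : ℂ) - lam (n + 1) / recurrenceRatio b lam n z) z
    exact (differentiableAt_id.sub_const _).sub
      ((differentiableAt_const _).div ih (recurrenceRatio_ne_zero hlam hz n))

/-- The limit of the ratios: the fixed point in the upper half-plane of `w ↦ z - c - a / w`. It is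
the attracting one, because `a < |r|²`. -/
theorem exists_fixedPoint {a : ℝ} (ha : 0 ≤ a) (c : ℝ) {z : ℂ} (hz : 0 < z.im) :
    ∃ r : ℂ, 0 < r.im ∧ z - c = r + a / r ∧ a < ‖r‖ ^ 2 := by
  obtain ⟨r, hr, h⟩ : ∃ r : ℂ, 0 < r.im ∧ z - c = r + a / r := by
    rcases ha.eq_or_lt with rfl | ha
    · exact ⟨z - c, by simpa using hz, by simp⟩
    obtain ⟨d, hd⟩ := IsAlgClosed.exists_pow_nat_eq (discrim 1 (-(z - c)) (a : ℂ)) two_pos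
    obtain ⟨x, hx⟩ := exists_quadratic_eq_zero (one_ne_zero (α := ℂ)) ⟨d, by rw [← hd, sq]⟩
    have hx0 : x ≠ 0 := by
      rintro rfl
      simp [ha.ne'] at hx
    have hxe : z - c = x + a / x := by
      field_simp
      linear_combination -hx
    have him := congrArg Complex.im hxe
    simp only [Complex.sub_im, Complex.ofReal_im, Complex.add_im, Complex.im_ofReal_div] at him
    rcases lt_trichotomy x.im 0 with h | h | h
    · refine ⟨a / x, ?_, ?_⟩
      · have : 0 < a * -x.im / ‖x‖ ^ 2 :=
          div_pos (mul_pos ha (by linarith)) (pow_pos (norm_pos_iff.2 hx0) 2)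
        rw [Complex.im_ofReal_div, ← neg_div, ← mul_neg]
        exact this
      · have : (a : ℂ) ≠ 0 := by exact_mod_cast ha.ne'
        rw [hxe, div_div_cancel₀ this, add_comm]
    · simp [h] at him
      exact absurd him hz.ne'
    · exact ⟨x, h, hxe⟩
  refine ⟨r, hr, h, ?_⟩
  have hr0 : r ≠ 0 := by
    rintro rfl
    simp at hr
  have hn : 0 < ‖r‖ ^ 2 := pow_pos (norm_pos_iff.2 hr0) 2
  have him := congrArg Complex.im h
  simp only [Complex.sub_im, Complex.ofReal_im, Complex.add_im, Complex.im_ofReal_div] at him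
  by_contra! hcon
  have : r.im ≤ a * r.im / ‖r‖ ^ 2 := by
    rw [le_div_iff₀ hn]
    nlinarith
  linarith

variable {a c : ℝ}

/-- Near the limit, in the coordinate `t = (w - r) / (w - a / r)` which sends the two fixed points
of `w ↦ z₀ - c - a / w` to `0` and `∞`, the recurrence is multiplication by `a / r²` up to an error
`d` which collects the differences between `z`, `b (n + 1)`, `lam (n + 1)` and `z₀`, `c`, `a`. -/
theorem tendsto_recurrenceRatio (hlam : ∀ n, 0 ≤ lam n)
    (hb : Tendsto b atTop (𝓝 c)) (hl : Tendsto lam atTop (𝓝 a)) (ha : 0 ≤ a)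
    {z₀ r : ℂ} (hz₀ : 0 < z₀.im) (hr : 0 < r.im) (hfix : z₀ - c = r + a / r) (har : a < ‖r‖ ^ 2) :
    Tendsto (fun y : ℕ × ℂ => recurrenceRatio b lam y.1 y.2) (atTop ×ˢ 𝓝 z₀) (𝓝 r) := by
  have hr0 : r ≠ 0 := by
    rintro rfl
    simp at hr
  set ρ : ℂ := a / r with hρ
  have hρim : ρ.im ≤ 0 := by
    rw [hρ, Complex.im_ofReal_div]
    have : 0 ≤ a * r.im / ‖r‖ ^ 2 := by positivity
    linarith
  have hρr : ‖ρ / r‖ < 1 := by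
    rw [hρ, div_div, norm_div, norm_mul, ← sq, Complex.norm_real, Real.norm_eq_abs,
      abs_of_nonneg ha, div_lt_one (by positivity)]
    exact har
  set p := recurrenceRatio b lam with hp
  set ε := z₀.im / 2 with hε
  have hε0 : 0 < ε := half_pos hz₀
  have hnear : ∀ᶠ z in 𝓝 z₀, ε < z.im :=
    Complex.continuous_im.continuousAt.eventually (lt_mem_nhds (by rw [hε]; linarith))
  have hpn : ∀ n z, ε < z.im → ε ≤ ‖p n z‖ := fun n z hz =>
    hz.le.trans (im_le_norm_recurrenceRatio hlam (hε0.trans hz) n)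
  have hfn : ∀ n z, ε < z.im → ε ≤ ‖p n z - ρ‖ := fun n z hz => by
    have h1 := im_le_im_recurrenceRatio (b := b) hlam (hε0.trans hz) n
    have h2 := (le_abs_self _).trans (Complex.abs_im_le_norm (p n z - ρ))
    rw [Complex.sub_im] at h2
    linarith
  let t : ℕ → ℂ → ℂ := fun n z => (p n z - r) / (p n z - ρ)
  let δ : ℕ × ℂ → ℂ := fun y =>
    (y.2 - z₀) + (c - b (y.1 + 1) : ℝ) + (a - lam (y.1 + 1) : ℝ) / p y.1 y.2
  let d : ℕ × ℂ → ℂ := fun y => δ y / (p (y.1 + 1) y.2 - ρ)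
  have hnear' : ∀ᶠ y : ℕ × ℂ in atTop ×ˢ 𝓝 z₀, ε < y.2.im := tendsto_snd.eventually hnear
  have hsucc : Tendsto (fun y : ℕ × ℂ => y.1 + 1) (atTop ×ˢ 𝓝 z₀) atTop :=
    (tendsto_add_atTop_nat 1).comp tendsto_fst
  have hd : Tendsto d (atTop ×ˢ 𝓝 z₀) (𝓝 0) := by
    have h1 : Tendsto (fun y : ℕ × ℂ => (‖y.2 - z₀‖ + |c - b (y.1 + 1)| +
        |a - lam (y.1 + 1)| / ε) / ε) (atTop ×ˢ 𝓝 z₀) (𝓝 0) := by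
      have e1 : Tendsto (fun y : ℕ × ℂ => ‖y.2 - z₀‖) (atTop ×ˢ 𝓝 z₀) (𝓝 0) := by
        simpa using ((tendsto_snd (f := (atTop : Filter ℕ)) (g := 𝓝 z₀)).sub_const z₀).norm
      have e2 : Tendsto (fun y : ℕ × ℂ => |c - b (y.1 + 1)|) (atTop ×ˢ 𝓝 z₀) (𝓝 0) := by
        simpa using ((hb.comp hsucc).const_sub c).abs
      have e3 : Tendsto (fun y : ℕ × ℂ => |a - lam (y.1 + 1)|) (atTop ×ˢ 𝓝 z₀) (𝓝 0) := by
        simpa using ((hl.comp hsucc).const_sub a).abs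
      simpa using ((e1.add e2).add (e3.div_const ε)).div_const ε
    refine squeeze_zero_norm' ?_ h1
    filter_upwards [hnear'] with y hy
    change ‖δ y / _‖ ≤ _
    rw [norm_div]
    refine div_le_div₀ (by positivity) ?_ hε0 (hfn _ _ hy)
    refine (norm_add₃_le).trans (add_le_add (add_le_add le_rfl ?_) ?_)
    · rw [Complex.norm_real, Real.norm_eq_abs]
    · rw [norm_div, Complex.norm_real, Real.norm_eq_abs]
      exact div_le_div_of_nonneg_left (abs_nonneg _) hε0 (hpn _ _ hy)
  -- `hρim` keeps the denominators `p n z - ρ` away from zero, so the error `d` is as small as `δ`.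
  have hstep : ∀ n z, ε < z.im → t (n + 1) z = d (n, z) + ρ / r * t n z * (1 - d (n, z)) := by
    intro n z hz
    have hp0 : p n z ≠ 0 := norm_pos_iff.1 (hε0.trans_le (hpn n z hz))
    have hf0 : p n z - ρ ≠ 0 := norm_pos_iff.1 (hε0.trans_le (hfn n z hz))
    have hf1 : p (n + 1) z - ρ ≠ 0 := norm_pos_iff.1 (hε0.trans_le (hfn (n + 1) z hz))
    have hrec : p (n + 1) z = z - b (n + 1) - lam (n + 1) / p n z := rfl
    have haρ : (a : ℂ) = ρ * r := by rw [hρ, div_mul_cancel₀ _ hr0]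
    have he : p (n + 1) z - r = δ (n, z) + ρ / p n z * (p n z - r) := by
      simp only [hrec, δ]
      push_cast
      rw [haρ]
      field_simp
      linear_combination p n z * hfix
    have hf : p (n + 1) z - ρ = δ (n, z) + r / p n z * (p n z - ρ) := by
      simp only [hrec, δ]
      push_cast
      rw [haρ]
      field_simp
      linear_combination p n z * hfix
    have hdm : δ (n, z) = d (n, z) * (p (n + 1) z - ρ) := (div_mul_cancel₀ _ hf1).symm
    have h1 : (1 - d (n, z)) * (p (n + 1) z - ρ) = r / p n z * (p n z - ρ) := by
      linear_combination hf + hdm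
    change (p (n + 1) z - r) / (p (n + 1) z - ρ) =
      d (n, z) + ρ / r * ((p n z - r) / (p n z - ρ)) * (1 - d (n, z))
    rw [div_eq_iff hf1, add_mul, ← hdm, he, mul_assoc, h1]
    field_simp
  have hstepn : ∀ n z, ε < z.im →
      ‖t (n + 1) z‖ ≤ ‖ρ / r‖ * (1 + ‖d (n, z)‖) * ‖t n z‖ + ‖d (n, z)‖ := by
    intro n z hz
    rw [hstep n z hz]
    refine (norm_add_le _ _).trans ?_
    rw [norm_mul, norm_mul]
    have : ‖1 - d (n, z)‖ ≤ 1 + ‖d (n, z)‖ := by simpa using norm_sub_le 1 (d (n, z))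
    have := mul_le_mul_of_nonneg_left this (by positivity : 0 ≤ ‖ρ / r‖ * ‖t n z‖)
    linarith
  have ht : Tendsto (fun y : ℕ × ℂ => ‖t y.1 y.2‖) (atTop ×ˢ 𝓝 z₀) (𝓝 0) := by
    refine tendsto_zero_of_le_mul_add (x := fun n z => ‖t n z‖)
      (g := fun y => ‖ρ / r‖ * (1 + ‖d y‖)) (h := fun y => ‖d y‖) (q := ‖ρ / r‖)
      (fun _ _ => norm_nonneg _) hρr ?_ ?_ (fun n => ⟨1 + ‖r - ρ‖ / ε, ?_⟩) ?_
    · simpa using (hd.norm.const_add 1).const_mul ‖ρ / r‖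
    · simpa using hd.norm
    · filter_upwards [hnear] with z hz
      have hf0 : p n z - ρ ≠ 0 := norm_pos_iff.1 (hε0.trans_le (hfn n z hz))
      have : t n z = 1 - (r - ρ) / (p n z - ρ) := by
        simp only [t]
        field_simp
        ring
      rw [this]
      refine (norm_sub_le _ _).trans ?_
      rw [norm_one, norm_div]
      gcongr
      exact hfn n z hz
    · filter_upwards [hnear'] with y hy using hstepn _ _ hy
  have ht0 : Tendsto (fun y : ℕ × ℂ => t y.1 y.2) (atTop ×ˢ 𝓝 z₀) (𝓝 0) :=
    tendsto_zero_iff_norm_tendsto_zero.2 ht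
  have hlim : Tendsto (fun y : ℕ × ℂ => (r - ρ * t y.1 y.2) / (1 - t y.1 y.2))
      (atTop ×ˢ 𝓝 z₀) (𝓝 r) := by
    simpa [Pi.div_def] using ((ht0.const_mul ρ).const_sub r).div (ht0.const_sub 1) (by simp)
  refine hlim.congr' ?_
  filter_upwards [hnear', ht0.eventually_ne zero_ne_one] with y hy hy1
  have hf0 : p y.1 y.2 - ρ ≠ 0 := norm_pos_iff.1 (hε0.trans_le (hfn _ _ hy))
  have h1 : 1 - t y.1 y.2 ≠ 0 := sub_ne_zero.2 hy1.symm
  have h2 : t y.1 y.2 * (p y.1 y.2 - ρ) = p y.1 y.2 - r := div_mul_cancel₀ _ hf0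
  rw [div_eq_iff h1]
  linear_combination h2

/-- The divided differences of the ratios with respect to the argument: by the recurrence, the
difference of `recurrenceRatio b lam n` at `w₁` and `w₂` is `w₁ - w₂` times this number. -/
noncomputable def ratioSlope (b lam : ℕ → ℝ) : ℕ → ℂ × ℂ → ℂ
  | 0, _ => 1
  | n + 1, w => 1 + lam (n + 1) / (recurrenceRatio b lam n w.1 * recurrenceRatio b lam n w.2) *
      ratioSlope b lam n w

theorem recurrenceRatio_sub (hlam : ∀ n, 0 ≤ lam n) {w : ℂ × ℂ} (h₁ : w.1.im ≠ 0)
    (h₂ : w.2.im ≠ 0) (n : ℕ) :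
    recurrenceRatio b lam n w.1 - recurrenceRatio b lam n w.2 =
      ratioSlope b lam n w * (w.1 - w.2) := by
  induction n with
  | zero => simp [recurrenceRatio, ratioSlope]
  | succ n ih =>
    have := recurrenceRatio_ne_zero (b := b) hlam h₁ n
    have := recurrenceRatio_ne_zero (b := b) hlam h₂ n
    simp only [recurrenceRatio, ratioSlope]
    field_simp
    linear_combination (lam (n + 1) : ℂ) * ih

theorem tendsto_ratioSlope (hlam : ∀ n, 0 ≤ lam n)
    (hb : Tendsto b atTop (𝓝 c)) (hl : Tendsto lam atTop (𝓝 a)) (ha : 0 ≤ a)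
    {z₀ r : ℂ} (hz₀ : 0 < z₀.im) (hr : 0 < r.im) (hfix : z₀ - c = r + a / r) (har : a < ‖r‖ ^ 2) :
    Tendsto (fun y : ℕ × ℂ × ℂ => ratioSlope b lam y.1 y.2) (atTop ×ˢ 𝓝 (z₀, z₀))
      (𝓝 (1 - a / r ^ 2)⁻¹) := by
  have hr0 : r ≠ 0 := by
    rintro rfl
    simp at hr
  set q : ℂ := a / r ^ 2 with hq
  have hq1 : ‖q‖ < 1 := by
    rw [hq, norm_div, norm_pow, Complex.norm_real, Real.norm_eq_abs, abs_of_nonneg ha,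
      div_lt_one (by positivity)]
    exact har
  have hq0 : 1 - q ≠ 0 := by
    intro h
    rw [← sub_eq_zero.1 h] at hq1
    simp at hq1
  set D := (1 - q)⁻¹ with hD
  have hDq : D = 1 + q * D := by
    rw [hD]
    field_simp
    ring
  set μ : ℕ × ℂ × ℂ → ℂ := fun y =>
    lam (y.1 + 1) / (recurrenceRatio b lam y.1 y.2.1 * recurrenceRatio b lam y.1 y.2.2) with hμ
  have hlimp := tendsto_recurrenceRatio hlam hb hl ha hz₀ hr hfix har
  have hμlim : Tendsto μ (atTop ×ˢ 𝓝 (z₀, z₀)) (𝓝 q) := by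
    have e0 : Tendsto (fun y : ℕ × ℂ × ℂ => (lam (y.1 + 1) : ℂ)) (atTop ×ˢ 𝓝 (z₀, z₀)) (𝓝 a) :=
      (Complex.continuous_ofReal.tendsto a).comp
        (hl.comp ((tendsto_add_atTop_nat 1).comp tendsto_fst))
    have e1 : Tendsto (fun y : ℕ × ℂ × ℂ => recurrenceRatio b lam y.1 y.2.1)
        (atTop ×ˢ 𝓝 (z₀, z₀)) (𝓝 r) :=
      hlimp.comp (tendsto_fst.prodMk ((continuous_fst.tendsto (z₀, z₀)).comp tendsto_snd))
    have e2 : Tendsto (fun y : ℕ × ℂ × ℂ => recurrenceRatio b lam y.1 y.2.2)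
        (atTop ×ˢ 𝓝 (z₀, z₀)) (𝓝 r) :=
      hlimp.comp (tendsto_fst.prodMk ((continuous_snd.tendsto (z₀, z₀)).comp tendsto_snd))
    rw [hq, sq]
    exact e0.div (e1.mul e2) (mul_ne_zero hr0 hr0)
  have hstep : ∀ y : ℕ × ℂ × ℂ, ratioSlope b lam (y.1 + 1) y.2 - D =
      μ y * (ratioSlope b lam y.1 y.2 - D) + (μ y - q) * D := by
    intro y
    have : ratioSlope b lam (y.1 + 1) y.2 = 1 + μ y * ratioSlope b lam y.1 y.2 := rfl
    linear_combination this - hDq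
  have hnear : ∀ᶠ w : ℂ × ℂ in 𝓝 (z₀, z₀), z₀.im / 2 < w.1.im ∧ z₀.im / 2 < w.2.im := by
    have : ∀ᶠ w in 𝓝 z₀, z₀.im / 2 < w.im :=
      Complex.continuous_im.continuousAt.eventually (lt_mem_nhds (half_lt_self hz₀))
    rw [nhds_prod_eq]
    exact this.prod_mk this
  have hbdd : ∀ n, ∃ B, ∀ᶠ w in 𝓝 (z₀, z₀), ‖ratioSlope b lam n w‖ ≤ B := by
    intro n
    induction n with
    | zero => exact ⟨1, by simp [ratioSlope]⟩
    | succ n ih =>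
      obtain ⟨B, hB⟩ := ih
      refine ⟨1 + lam (n + 1) / (z₀.im / 2 * (z₀.im / 2)) * B, ?_⟩
      filter_upwards [hB, hnear] with w hw hw'
      have h₁ := hw'.1.le.trans
        (im_le_norm_recurrenceRatio (b := b) hlam ((half_pos hz₀).trans hw'.1) n)
      have h₂ := hw'.2.le.trans
        (im_le_norm_recurrenceRatio (b := b) hlam ((half_pos hz₀).trans hw'.2) n)
      simp only [ratioSlope]
      refine (norm_add_le _ _).trans ?_
      rw [norm_one, norm_mul, norm_div, norm_mul, Complex.norm_real, Real.norm_eq_abs,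
        abs_of_nonneg (hlam _)]
      have := hlam (n + 1)
      have := half_pos hz₀
      gcongr
  have h0 : Tendsto (fun y : ℕ × ℂ × ℂ => ‖ratioSlope b lam y.1 y.2 - D‖)
      (atTop ×ˢ 𝓝 (z₀, z₀)) (𝓝 0) := by
    refine tendsto_zero_of_le_mul_add (x := fun n w => ‖ratioSlope b lam n w - D‖)
      (g := fun y => ‖μ y‖) (h := fun y => ‖μ y - q‖ * ‖D‖)
      (fun _ _ => norm_nonneg _) hq1 hμlim.norm ?_ (fun n => ?_) (Eventually.of_forall fun y => ?_)
    · simpa using (hμlim.sub_const q).norm.mul_const ‖D‖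
    · obtain ⟨B, hB⟩ := hbdd n
      refine ⟨B + ‖D‖, ?_⟩
      filter_upwards [hB] with w hw
      exact (norm_sub_le _ _).trans (add_le_add_left hw _)
    · simp only [hstep]
      exact (norm_add_le _ _).trans (by rw [norm_mul, norm_mul])
  exact tendsto_iff_norm_sub_tendsto_zero.2 h0

/-- Near a point of the upper half-plane the ratios are eventually injective, with inverses that
are Lipschitz uniformly in `n`. -/
theorem exists_mul_le_norm_recurrenceRatio_sub (hlam : ∀ n, 0 ≤ lam n)
    (hb : Tendsto b atTop (𝓝 c)) (hl : Tendsto lam atTop (𝓝 a)) (ha : 0 ≤ a)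
    {z₀ : ℂ} (hz₀ : 0 < z₀.im) :
    ∃ m > 0, ∃ δ > 0, ∀ᶠ n in atTop, ∀ w₁ ∈ Metric.ball z₀ δ, ∀ w₂ ∈ Metric.ball z₀ δ,
      m * ‖w₁ - w₂‖ ≤ ‖recurrenceRatio b lam n w₁ - recurrenceRatio b lam n w₂‖ := by
  obtain ⟨r, hr, hfix, har⟩ := exists_fixedPoint ha c hz₀
  have hlim := (tendsto_ratioSlope hlam hb hl ha hz₀ hr hfix har).norm
  set D := (1 - a / r ^ 2)⁻¹ with hD
  have hD0 : 0 < ‖D‖ := by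
    refine norm_pos_iff.2 (inv_ne_zero fun h => ?_)
    have h1 : ‖(a : ℂ) / r ^ 2‖ = 1 := by rw [← sub_eq_zero.1 h, norm_one]
    have hr0 : r ≠ 0 := by
      rintro rfl
      simp at hr
    rw [norm_div, norm_pow, Complex.norm_real, Real.norm_eq_abs, abs_of_nonneg ha,
      div_eq_one_iff_eq (by positivity)] at h1
    exact har.ne h1
  obtain ⟨pa, hpa, pb, hpb, hall⟩ :=
    eventually_prod_iff.1 (hlim.eventually (lt_mem_nhds (half_lt_self hD0)))
  have him : ∀ᶠ w : ℂ in 𝓝 z₀, 0 < w.im :=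
    Complex.continuous_im.continuousAt.eventually (lt_mem_nhds hz₀)
  obtain ⟨δ₁, hδ₁, h₁⟩ := Metric.eventually_nhds_iff_ball.1 him
  obtain ⟨δ₂, hδ₂, h₂⟩ := Metric.eventually_nhds_iff_ball.1 hpb
  refine ⟨‖D‖ / 2, half_pos hD0, min δ₁ δ₂, lt_min hδ₁ hδ₂, ?_⟩
  filter_upwards [hpa] with n hn w₁ hw₁ w₂ hw₂
  have hi₁ := h₁ w₁ (Metric.ball_subset_ball (min_le_left _ _) hw₁)
  have hi₂ := h₁ w₂ (Metric.ball_subset_ball (min_le_left _ _) hw₂)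
  have hw : (w₁, w₂) ∈ Metric.ball (z₀, z₀) δ₂ := by
    rw [← ball_prod_same]
    exact ⟨Metric.ball_subset_ball (min_le_right _ _) hw₁,
      Metric.ball_subset_ball (min_le_right _ _) hw₂⟩
  have hs := hall hn (h₂ _ hw)
  rw [recurrenceRatio_sub (w := (w₁, w₂)) hlam hi₁.ne' hi₂.ne', norm_mul]
  exact mul_le_mul_of_nonneg_right hs.le (norm_nonneg _)
end

/-! ### Points at which two ratios agree -/

section
variable {a c : ℝ} {b b' lam : ℕ → ℝ}

theorem im_pos_of_recurrenceRatio_eq (hlam : ∀ n, 0 ≤ lam n) {κ w : ℂ} (hκ : 0 < κ.im)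
    (hw : w.im ≠ 0) {n : ℕ} (h : recurrenceRatio b lam n w = recurrenceRatio b' lam n κ) :
    0 < w.im := by
  by_contra! hcon
  have hw' : 0 < (starRingEnd ℂ w).im := by simpa using lt_of_le_of_ne hcon hw
  have h1 := im_le_im_recurrenceRatio (b := b) hlam hw' n
  rw [recurrenceRatio_conj, h] at h1
  simp only [Complex.conj_im] at h1 hw'
  have h2 := im_le_im_recurrenceRatio (b := b') hlam hκ n
  linarith

theorem tendsto_recurrenceRatio_apply (hlam : ∀ n, 0 ≤ lam n)
    (hb : Tendsto b atTop (𝓝 c)) (hl : Tendsto lam atTop (𝓝 a)) (ha : 0 ≤ a)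
    {z₀ r : ℂ} (hz₀ : 0 < z₀.im) (hr : 0 < r.im) (hfix : z₀ - c = r + a / r) (har : a < ‖r‖ ^ 2) :
    Tendsto (fun n => recurrenceRatio b lam n z₀) atTop (𝓝 r) :=
  (tendsto_recurrenceRatio hlam hb hl ha hz₀ hr hfix har).comp
    (tendsto_id.prodMk tendsto_const_nhds)

/-- The two ratios at `κ` have the same limit, and the image under the first of a small disc about `κ`
contains a disc of radius independent of `n`, by the quantitative open mapping theorem. -/
theorem eventually_exists_recurrenceRatio_eq (hlam : ∀ n, 0 ≤ lam n)
    (hb : Tendsto b atTop (𝓝 c)) (hb' : Tendsto b' atTop (𝓝 c)) (hl : Tendsto lam atTop (𝓝 a))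
    (ha : 0 ≤ a) {κ : ℂ} (hκ : 0 < κ.im) {δ : ℝ} (hδ : 0 < δ) :
    ∀ᶠ n in atTop, ∃ w ∈ Metric.ball κ δ, 0 < w.im ∧
      recurrenceRatio b lam n w = recurrenceRatio b' lam n κ := by
  obtain ⟨m, hm, δ₀, hδ₀, hinj⟩ := exists_mul_le_norm_recurrenceRatio_sub hlam hb hl ha hκ
  obtain ⟨r, hr, hfix, har⟩ := exists_fixedPoint ha c hκ
  have h1 := tendsto_recurrenceRatio_apply hlam hb hl ha hκ hr hfix har
  have h2 := tendsto_recurrenceRatio_apply hlam hb' hl ha hκ hr hfix har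
  have him : ∀ᶠ w : ℂ in 𝓝 κ, 0 < w.im :=
    Complex.continuous_im.continuousAt.eventually (lt_mem_nhds hκ)
  obtain ⟨δ₁, hδ₁, him⟩ := Metric.eventually_nhds_iff_ball.1 him
  obtain ⟨η, hη0, hη⟩ := exists_between (lt_min hδ (lt_min hδ₀ hδ₁))
  obtain ⟨hη1, hη2, hη3⟩ : η < δ ∧ η < δ₀ ∧ η < δ₁ := by simpa using hη
  have hclose : ∀ᶠ n in atTop,
      dist (recurrenceRatio b' lam n κ) (recurrenceRatio b lam n κ) < m * η / 2 := by
    have := (h2.dist h1)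
    rw [dist_self] at this
    exact this.eventually (gt_mem_nhds (by positivity))
  filter_upwards [hinj, hclose] with n hn hc
  have hsub : ∀ w ∈ Metric.closedBall κ η, 0 < w.im := fun w hw =>
    him w (Metric.closedBall_subset_ball hη3 hw)
  have hlow : ∀ w ∈ Metric.closedBall κ η,
      m * ‖w - κ‖ ≤ ‖recurrenceRatio b lam n w - recurrenceRatio b lam n κ‖ := fun w hw =>
    hn w (Metric.closedBall_subset_ball hη2 hw) κ (Metric.mem_ball_self hδ₀)
  have hdiff : DiffContOnCl ℂ (recurrenceRatio b lam n) (Metric.ball κ η) := by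
    apply DifferentiableOn.diffContOnCl
    rw [closure_ball κ hη0.ne']
    exact fun w hw =>
      (differentiableAt_recurrenceRatio hlam (hsub w hw).ne' n).differentiableWithinAt
  have hfreq : ∃ᶠ w in 𝓝 κ, recurrenceRatio b lam n w ≠ recurrenceRatio b lam n κ := by
    have hne : ∃ᶠ w in 𝓝 κ, w ≠ κ := by
      have : ∃ᶠ w in 𝓝[≠] κ, True := Eventually.frequently (by simp)
      simpa [frequently_nhdsWithin_iff] using this
    refine (hne.and_eventually (Metric.closedBall_mem_nhds κ hη0)).mono fun w hw heq => ?_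
    have h := hlow w hw.2
    rw [heq, sub_self, norm_zero] at h
    have : 0 < m * ‖w - κ‖ := mul_pos hm (norm_pos_iff.2 (sub_ne_zero.2 hw.1))
    linarith
  have hsphere : ∀ w ∈ Metric.sphere κ η,
      m * η ≤ ‖recurrenceRatio b lam n w - recurrenceRatio b lam n κ‖ := by
    intro w hw
    have := hlow w (Metric.sphere_subset_closedBall hw)
    rwa [mem_sphere_iff_norm.1 hw] at this
  obtain ⟨w, hw, hweq⟩ := hdiff.ball_subset_image_closedBall hη0 hsphere hfreq hc
  exact ⟨w, Metric.closedBall_subset_ball hη1 hw, hsub w hw, hweq⟩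

/-- Since `z` is determined by the limit `r` through `z = c + r + a / r`, a compactness argument
excludes further solutions in the part `ε ≤ Im w` of the half-plane. -/
theorem eventually_mem_ball_of_recurrenceRatio_eq (hlam : ∀ n, 0 ≤ lam n)
    (hb : Tendsto b atTop (𝓝 c)) (hb' : Tendsto b' atTop (𝓝 c)) (hl : Tendsto lam atTop (𝓝 a))
    (ha : 0 ≤ a) {κ : ℂ} (hκ : 0 < κ.im) {δ ε : ℝ} (hδ : 0 < δ) (hε : 0 < ε) :
    ∀ᶠ n in atTop, ∀ w : ℂ, ε ≤ w.im →
      recurrenceRatio b lam n w = recurrenceRatio b' lam n κ → w ∈ Metric.ball κ δ := by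
  obtain ⟨r, hr, hfix, har⟩ := exists_fixedPoint ha c hκ
  have h2 := tendsto_recurrenceRatio_apply hlam hb' hl ha hκ hr hfix har
  -- Solutions are bounded because their ratios are, and the ratios dominate the argument.
  obtain ⟨M, hM⟩ : ∃ M, ∀ᶠ n in atTop, ∀ w : ℂ, ε ≤ w.im →
      recurrenceRatio b lam n w = recurrenceRatio b' lam n κ → ‖w‖ ≤ M := by
    refine ⟨(‖r‖ + 1) + (|c| + 1) + (a + 1) / ε, ?_⟩
    filter_upwards [h2.norm.eventually (gt_mem_nhds (lt_add_one _)),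
      hb.abs.eventually (gt_mem_nhds (lt_add_one _)),
      hl.eventually (gt_mem_nhds (lt_add_one _)), eventually_ge_atTop 1] with n hn1 hn2 hn3 hn w hw heq
    obtain ⟨n, rfl⟩ : ∃ k, n = k + 1 := ⟨n - 1, by omega⟩
    have hw' : w = recurrenceRatio b' lam (n + 1) κ + b (n + 1) +
        lam (n + 1) / recurrenceRatio b lam n w := by
      rw [← heq]
      simp only [recurrenceRatio]
      ring
    rw [hw']
    refine norm_add₃_le.trans (add_le_add (add_le_add hn1.le ?_) ?_)
    · rw [Complex.norm_real]
      exact hn2.le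
    · rw [norm_div, Complex.norm_real, Real.norm_eq_abs, abs_of_nonneg (hlam _)]
      have := hw.trans (im_le_norm_recurrenceRatio (b := b) hlam (hε.trans_le hw) n)
      gcongr
  set K : Set ℂ := ({w | ε ≤ w.im} ∩ Metric.closedBall 0 M) \ Metric.ball κ δ with hK
  have hKc : IsCompact K :=
    ((isCompact_closedBall 0 M).inter_left (isClosed_le continuous_const Complex.continuous_im)).diff
      Metric.isOpen_ball
  have hloc : ∀ w₀ ∈ K, ∀ᶠ y : ℕ × ℂ in atTop ×ˢ 𝓝 w₀,
      recurrenceRatio b lam y.1 y.2 ≠ recurrenceRatio b' lam y.1 κ := by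
    rintro w₀ ⟨⟨hw₀, -⟩, hw₀'⟩
    have hw₀pos : 0 < w₀.im := hε.trans_le hw₀
    obtain ⟨r', hr', hfix', har'⟩ := exists_fixedPoint ha c hw₀pos
    have hlim := tendsto_recurrenceRatio hlam hb hl ha hw₀pos hr' hfix' har'
    have hne : r' - r ≠ 0 := by
      intro h
      rw [sub_eq_zero.1 h, ← hfix] at hfix'
      rw [sub_left_inj.1 hfix'] at hw₀'
      exact hw₀' (Metric.mem_ball_self hδ)
    filter_upwards [(hlim.sub (h2.comp tendsto_fst)).eventually_ne hne] with y hy heq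
    exact hy (by simp [heq])
  have hfin : ∀ᶠ n in atTop, ∀ w ∈ K,
      recurrenceRatio b lam n w ≠ recurrenceRatio b' lam n κ := by
    have : ∀ᶠ y : ℕ × ℂ in atTop ×ˢ 𝓝ˢ K,
        recurrenceRatio b lam y.1 y.2 ≠ recurrenceRatio b' lam y.1 κ :=
      hKc.mem_prod_nhdsSet_of_forall hloc
    exact this.curry.mono fun _ h => h.self_of_nhdsSet
  filter_upwards [hM, hfin] with n hn hn' w hw heq
  by_contra hcon
  exact hn' w ⟨⟨hw, by simpa using hn w hw heq⟩, hcon⟩ heq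

/-! ### Zeros of the perturbed polynomials -/

/-- The case `Im κ > 0`: the zeros off the real line are the points at which the ratio
of the `P n` takes the value `recurrenceRatio b' lam n κ`. -/
theorem exists_tendsto_root_of_im_pos (hlam : ∀ n, 0 ≤ lam n)
    (hb : Tendsto b atTop (𝓝 c)) (hb' : Tendsto b' atTop (𝓝 c)) (hl : Tendsto lam atTop (𝓝 a))
    (ha : 0 ≤ a) {P : ℕ → ℂ[X]} (hmonic : ∀ n, (P n).Monic) (hdeg : ∀ n, (P n).natDegree = n)
    (hP : ∀ n z, z.im ≠ 0 → (P (n + 1)).eval z = recurrenceRatio b lam n z * (P n).eval z)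
    {κ : ℂ} (hκ : 0 < κ.im) {G : ℕ → ℂ[X]} (hGdeg : ∀ n, (G n).natDegree = n + 1)
    (hG : ∀ n, G n = P (n + 1) - C (recurrenceRatio b' lam n κ) * P n) :
    ∃ ξ : ℕ → ℂ, (∀ n, (G n).IsRoot (ξ n)) ∧ Tendsto ξ atTop (𝓝 κ) ∧
      ∀ ε : ℝ, 0 < ε → ∀ᶠ n in atTop, ∀ w ∈ (G n).roots.erase (ξ n), |w.im| < ε := by
  have hG0 : ∀ n, G n ≠ 0 := fun n => ne_zero_of_natDegree_gt (n := n) (by rw [hGdeg]; omega)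
  have hP0 : ∀ n z, z.im ≠ 0 → (P n).eval z ≠ 0 := by
    intro n z hz
    induction n with
    | zero => simp [(hmonic 0).natDegree_eq_zero.1 (hdeg 0)]
    | succ n ih => rw [hP n z hz]; exact mul_ne_zero (recurrenceRatio_ne_zero hlam hz n) ih
  have hGe : ∀ n z, z.im ≠ 0 → (G n).eval z =
      (recurrenceRatio b lam n z - recurrenceRatio b' lam n κ) * (P n).eval z := by
    intro n z hz
    rw [hG, eval_sub, eval_mul, eval_C, hP n z hz]
    ring
  have hroot : ∀ n z, z.im ≠ 0 → ((G n).IsRoot z ↔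
      recurrenceRatio b lam n z = recurrenceRatio b' lam n κ) := by
    intro n z hz
    rw [IsRoot, hGe n z hz, mul_eq_zero, or_iff_left (hP0 n z hz), sub_eq_zero]
  -- `ξ n` is a zero of `G n` nearest to `κ`.
  have hex : ∀ n, ∃ ξ, (G n).IsRoot ξ ∧ ∀ w, (G n).IsRoot w → dist ξ κ ≤ dist w κ := by
    intro n
    obtain ⟨z, hz⟩ := IsAlgClosed.exists_root (G n) (by
      rw [degree_eq_natDegree (hG0 n), hGdeg]; exact_mod_cast n.succ_ne_zero)
    obtain ⟨ξ, hξ, hmin⟩ := (G n).roots.toFinset.exists_min_image (fun w => dist w κ)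
      ⟨z, by simpa [hG0 n] using hz⟩
    exact ⟨ξ, by simpa [hG0 n] using hξ, fun w hw => hmin w (by simpa [hG0 n] using hw)⟩
  choose ξ hξ hmin using hex
  have hξlim : Tendsto ξ atTop (𝓝 κ) := by
    rw [Metric.tendsto_nhds]
    intro δ hδ
    filter_upwards [eventually_exists_recurrenceRatio_eq hlam hb hb' hl ha hκ hδ]
      with n ⟨w, hw, hwim, heq⟩
    exact (hmin n w ((hroot n w hwim.ne').2 heq)).trans_lt hw
  refine ⟨ξ, hξ, hξlim, fun ε hε => ?_⟩
  obtain ⟨m, hm, δ, hδ, hinj⟩ := exists_mul_le_norm_recurrenceRatio_sub hlam hb hl ha hκ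
  filter_upwards [hinj, eventually_mem_ball_of_recurrenceRatio_eq hlam hb hb' hl ha hκ hδ hε,
    hξlim.eventually (Metric.ball_mem_nhds κ hδ),
    (Complex.continuous_im.continuousAt.tendsto.comp hξlim).eventually (lt_mem_nhds hκ)]
    with n hn hloc hξball hξim w hw
  by_contra! hcon
  have hwim : w.im ≠ 0 := by
    intro h
    rw [h, abs_zero] at hcon
    linarith
  have hwroot : (G n).IsRoot w := isRoot_of_mem_roots (Multiset.mem_of_mem_erase hw)
  have heq := (hroot n w hwim).1 hwroot
  have hwpos := im_pos_of_recurrenceRatio_eq hlam hκ hwim heq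
  rw [abs_of_pos hwpos] at hcon
  have hwball := hloc w hcon heq
  have hξeq := (hroot n (ξ n) hξim.ne').1 (hξ n)
  have hwξ : w = ξ n := by
    have h := hn w hwball (ξ n) hξball
    rw [heq, hξeq, sub_self, norm_zero] at h
    by_contra hne
    have : 0 < m * ‖w - ξ n‖ := mul_pos hm (norm_pos_iff.2 (sub_ne_zero.2 hne))
    linarith
  -- A double zero would make the difference quotient of the ratio vanish in the limit.
  subst hwξ
  have hcount : 2 ≤ (G n).roots.count (ξ n) := by
    have := Multiset.one_le_count_iff_mem.2 hw
    rw [Multiset.count_erase_self] at this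
    omega
  rw [count_roots, le_rootMultiplicity_iff (hG0 n)] at hcount
  obtain ⟨H, hH⟩ := hcount
  have hball : Metric.ball κ δ ∩ {z | 0 < z.im} ∈ 𝓝 (ξ n) :=
    (Metric.isOpen_ball.inter (isOpen_lt continuous_const Complex.continuous_im)).mem_nhds
      ⟨hξball, hξim⟩
  have hle : ∀ᶠ z in 𝓝[≠] ξ n, m * ‖(P n).eval z‖ ≤ ‖z - ξ n‖ * ‖H.eval z‖ := by
    filter_upwards [nhdsWithin_le_nhds hball, self_mem_nhdsWithin] with z hz hzne
    have h := hn z hz.1 (ξ n) hξball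
    have h0 : 0 < ‖z - ξ n‖ := norm_pos_iff.2 (sub_ne_zero.2 hzne)
    have h1 : ‖recurrenceRatio b lam n z - recurrenceRatio b lam n (ξ n)‖ * ‖(P n).eval z‖ =
        ‖z - ξ n‖ ^ 2 * ‖H.eval z‖ := by
      rw [hξeq, ← norm_mul, ← hGe n z hz.2.ne', hH]
      simp
    have h2 := mul_le_mul_of_nonneg_right h (norm_nonneg ((P n).eval z))
    rw [h1] at h2
    refine le_of_mul_le_mul_left ?_ h0
    linarith
  have hl1 : Tendsto (fun z => m * ‖(P n).eval z‖) (𝓝[≠] ξ n) (𝓝 (m * ‖(P n).eval (ξ n)‖)) :=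
    (((P n).continuous.norm.const_mul m).tendsto _).mono_left nhdsWithin_le_nhds
  have hl2 : Tendsto (fun z => ‖z - ξ n‖ * ‖H.eval z‖) (𝓝[≠] ξ n) (𝓝 0) := by
    have : Continuous fun z => ‖z - ξ n‖ * ‖H.eval z‖ := by
      have := H.continuous
      fun_prop
    simpa using (this.tendsto (ξ n)).mono_left nhdsWithin_le_nhds
  have hfinal := le_of_tendsto_of_tendsto hl1 hl2 hle
  have : 0 < m * ‖(P n).eval (ξ n)‖ := mul_pos hm (norm_pos_iff.2 (hP0 n _ hξim.ne'))
  linarith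

/-- The case `Im κ < 0` follows by complex conjugation, since the `P n` are real. -/
theorem exists_tendsto_root (hlam : ∀ n, 0 ≤ lam n)
    (hb : Tendsto b atTop (𝓝 c)) (hb' : Tendsto b' atTop (𝓝 c)) (hl : Tendsto lam atTop (𝓝 a))
    (ha : 0 ≤ a) {P : ℕ → ℂ[X]} (hmonic : ∀ n, (P n).Monic) (hdeg : ∀ n, (P n).natDegree = n)
    (hreal : ∀ n, (P n).map (starRingEnd ℂ) = P n)
    (hP : ∀ n z, z.im ≠ 0 → (P (n + 1)).eval z = recurrenceRatio b lam n z * (P n).eval z)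
    {κ : ℂ} (hκ : κ.im ≠ 0) {G : ℕ → ℂ[X]} (hGdeg : ∀ n, (G n).natDegree = n + 1)
    (hG : ∀ n, G n = P (n + 1) - C (recurrenceRatio b' lam n κ) * P n) :
    ∃ ξ : ℕ → ℂ, (∀ n, (G n).IsRoot (ξ n)) ∧ Tendsto ξ atTop (𝓝 κ) ∧
      ∀ ε : ℝ, 0 < ε → ∀ᶠ n in atTop, ∀ w ∈ (G n).roots.erase (ξ n), |w.im| < ε := by
  rcases hκ.lt_or_gt with h | h
  · obtain ⟨ξ, hξ, hlim, him⟩ := exists_tendsto_root_of_im_pos hlam hb hb' hl ha hmonic hdeg hP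
      (κ := starRingEnd ℂ κ) (G := fun n => (G n).map (starRingEnd ℂ)) (by simpa using h)
      (fun n => by rw [natDegree_map, hGdeg])
      (fun n => by rw [hG, Polynomial.map_sub, Polynomial.map_mul, hreal, hreal, map_C,
        recurrenceRatio_conj])
    refine ⟨fun n => starRingEnd ℂ (ξ n), fun n => ?_, ?_, fun ε hε => ?_⟩
    · have := (hξ n).map (f := starRingEnd ℂ)
      rwa [Polynomial.map_map, show (starRingEnd ℂ).comp (starRingEnd ℂ) = RingHom.id ℂ from
        RingHom.ext Complex.conj_conj, Polynomial.map_id] at this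
    · simpa [Function.comp_def] using (Complex.continuous_conj.tendsto _).comp hlim
    · filter_upwards [him ε hε] with n hn w hw
      have hw' : starRingEnd ℂ w ∈ ((G n).map (starRingEnd ℂ)).roots.erase (ξ n) := by
        rw [(IsAlgClosed.splits (G n)).roots_map]
        have h1 := Multiset.mem_map_of_mem (starRingEnd ℂ) hw
        rwa [Multiset.map_erase _ (starRingEnd ℂ).injective, Complex.conj_conj] at h1
      simpa using hn _ hw'
  · exact exists_tendsto_root_of_im_pos hlam hb hb' hl ha hmonic hdeg hP h hGdeg hG
end

/-! ### Orthogonality and the reality of the recurrence -/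

theorem LinearMap.map_C_mul (L : ℂ[X] →ₗ[ℂ] ℂ) (x : ℂ) (p : ℂ[X]) : L (C x * p) = x * L p := by
  rw [← smul_eq_C_mul, map_smul, smul_eq_mul]

/-- A real polynomial is a difference of two squares of real polynomials, up to a factor. -/
theorem IsPositiveDefinite.im_map {L : ℂ[X] →ₗ[ℂ] ℂ} (hL : IsPositiveDefinite L) (p : ℝ[X]) :
    (L (p.map Complex.ofRealHom)).im = 0 := by
  have hsq : ∀ q : ℝ[X], (L ((q ^ 2).map Complex.ofRealHom)).im = 0 := fun q => by
    by_cases hq : q = 0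
    · simp [hq]
    · exact (hL (q ^ 2) (pow_ne_zero 2 hq) fun x => by rw [eval_pow]; positivity).2
  have hp : C 4 * p = (p + 1) ^ 2 - (p - 1) ^ 2 := by
    rw [show (C 4 : ℝ[X]) = 4 from rfl]
    ring
  have h := congrArg (fun q : ℝ[X] => (L (q.map Complex.ofRealHom)).im) hp
  simp only [Polynomial.map_sub, Polynomial.map_mul, map_C, LinearMap.map_C_mul, map_sub,
    Complex.sub_im, hsq] at h
  simpa using h

theorem IsPositiveDefinite.sq_pos {L : ℂ[X] →ₗ[ℂ] ℂ} (hL : IsPositiveDefinite L) {p : ℝ[X]}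
    (hp : p ≠ 0) : 0 < (L (p.map Complex.ofRealHom ^ 2)).re := by
  rw [← Polynomial.map_pow]
  exact (hL (p ^ 2) (pow_ne_zero 2 hp) fun x => by rw [eval_pow]; positivity).1

theorem IsMonicOPS.apply_mul_eq_zero {L : ℂ[X] →ₗ[ℂ] ℂ} {P : ℕ → ℂ[X]} (hP : IsMonicOPS L P)
    {n : ℕ} {q : ℂ[X]} (hq : q.degree < n) : L (P n * q) = 0 := by
  suffices h : ∀ d ≤ n, ∀ q : ℂ[X], q.degree < d → L (P n * q) = 0 from h n le_rfl q hq
  intro d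
  induction d with
  | zero =>
    intro _ q hq
    have : q = 0 := by
      rw [degree_lt_iff_coeff_zero] at hq
      ext m
      simpa using hq m (Nat.zero_le m)
    simp [this]
  | succ d ih =>
    intro hd q hq
    have hlow : (q - C (q.coeff d) * P d).degree < d := by
      rw [degree_lt_iff_coeff_zero] at hq ⊢
      intro m hm
      rw [coeff_sub, coeff_C_mul]
      rcases hm.eq_or_lt with rfl | hm
      · have := (hP.monic d).coeff_natDegree
        rw [hP.natDegree_eq] at this
        rw [this, mul_one, sub_self]
      · have : (P d).coeff m = 0 := coeff_eq_zero_of_natDegree_lt (by rwa [hP.natDegree_eq])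
        rw [hq m hm, this, mul_zero, sub_zero]
    have h := ih (by omega) _ hlow
    rwa [mul_sub, map_sub, mul_left_comm, LinearMap.map_C_mul, hP.orthogonal n d (by omega),
      mul_zero, sub_zero] at h

theorem Complex.eq_ofReal_of_mul_eq {x y z : ℂ} (hy : 0 < y.re) (hyi : y.im = 0) (hz : z.im = 0)
    (h : x * y = z) : x = ((z.re / y.re : ℝ) : ℂ) := by
  have hy' : y = (y.re : ℂ) := Complex.ext rfl (by simpa using hyi)
  have hz' : z = (z.re : ℂ) := Complex.ext rfl (by simpa using hz)
  have h0 : (y.re : ℂ) ≠ 0 := by exact_mod_cast hy.ne'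
  rw [hy', hz'] at h
  push_cast
  rw [eq_div_iff h0, h]

/-- The coefficients are quotients of values of `L` on real polynomials: `cₙ₊₁` is
`L[z Pₙ²] / L[Pₙ²]` and `λₙ₊₂` is `L[Pₙ₊₁²] / L[Pₙ²]`. -/
theorem IsMonicOPS.real_recurrence {L : ℂ[X] →ₗ[ℂ] ℂ} (hL : IsPositiveDefinite L) {P : ℕ → ℂ[X]}
    (hP : IsMonicOPS L P) {cs lam : ℕ → ℂ} (h0 : P 0 = 1) (h1 : P 1 = X - C (cs 1))
    (h2 : ∀ n, P (n + 2) = (X - C (cs (n + 2))) * P (n + 1) - C (lam (n + 2)) * P n) :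
    (∀ n, ∃ p : ℝ[X], P n = p.map Complex.ofRealHom) ∧
      (∀ n, cs (n + 1) = ((cs (n + 1)).re : ℂ)) ∧
      ∀ n, 0 ≤ (lam (n + 2)).re ∧ lam (n + 2) = ((lam (n + 2)).re : ℂ) := by
  have hsq : ∀ n, ∀ p : ℝ[X], P n = p.map Complex.ofRealHom →
      0 < (L (P n ^ 2)).re ∧ (L (P n ^ 2)).im = 0 := by
    intro n p hp
    have hp0 : p ≠ 0 := by
      rintro rfl
      exact (hP.monic n).ne_zero (by simpa using hp)
    rw [hp]
    refine ⟨hL.sq_pos hp0, ?_⟩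
    rw [← Polynomial.map_pow]
    exact hL.im_map _
  have hcs : ∀ n, cs (n + 1) * L (P n ^ 2) = L (X * P n ^ 2) := by
    intro n
    have horth := hP.orthogonal (n + 1) n (by omega)
    rcases n with _ | n
    · rw [zero_add, h1, sub_mul, map_sub, LinearMap.map_C_mul, h0] at horth
      rw [zero_add, h0, one_pow, mul_one]
      rw [mul_one, sub_eq_zero] at horth
      exact horth.symm
    · rw [h2, show ((X - C (cs (n + 2))) * P (n + 1) - C (lam (n + 2)) * P n) * P (n + 1) =
        X * P (n + 1) ^ 2 - C (cs (n + 2)) * P (n + 1) ^ 2 - C (lam (n + 2)) * (P n * P (n + 1))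
        by ring, map_sub, map_sub, LinearMap.map_C_mul, LinearMap.map_C_mul,
        hP.orthogonal n (n + 1) (by omega)] at horth
      linear_combination -horth
  have hlam : ∀ n, lam (n + 2) * L (P n ^ 2) = L (P (n + 1) ^ 2) := by
    intro n
    have horth := hP.orthogonal (n + 2) n (by omega)
    rw [h2, show ((X - C (cs (n + 2))) * P (n + 1) - C (lam (n + 2)) * P n) * P n =
        P (n + 1) * (X * P n) - C (cs (n + 2)) * (P (n + 1) * P n) - C (lam (n + 2)) * P n ^ 2
        by ring, map_sub, map_sub, LinearMap.map_C_mul, LinearMap.map_C_mul,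
        hP.orthogonal (n + 1) n (by omega)] at horth
    have hX : L (P (n + 1) * (X * P n)) = L (P (n + 1) ^ 2) := by
      -- `z Pₙ - Pₙ₊₁` has degree at most `n`.
      have hdeg : (X * P n - P (n + 1)).degree < ((n + 1 : ℕ) : WithBot ℕ) := by
        have hm : (X * P n).Monic := monic_X.mul (hP.monic n)
        have hd : (X * P n).degree = ((n + 1 : ℕ) : WithBot ℕ) := by
          rw [degree_eq_natDegree hm.ne_zero, monic_X.natDegree_mul (hP.monic n), natDegree_X,
            hP.natDegree_eq, add_comm]
        rw [← hd]
        refine degree_sub_lt_left ?_ hm.ne_zero ?_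
        · rw [hd, degree_eq_natDegree (hP.monic _).ne_zero, hP.natDegree_eq]
        · rw [hm, hP.monic]
      have := hP.apply_mul_eq_zero hdeg
      rw [mul_sub, map_sub, sub_eq_zero] at this
      rw [this, sq]
    rw [hX] at horth
    linear_combination -horth
  have hcreal : ∀ n, ∀ p : ℝ[X], P n = p.map Complex.ofRealHom →
      cs (n + 1) = ((cs (n + 1)).re : ℂ) := by
    intro n p hp
    have hi : (L (X * P n ^ 2)).im = 0 := by
      have := hL.im_map (X * p ^ 2)
      rwa [Polynomial.map_mul, Polynomial.map_pow, map_X, ← hp] at this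
    have := Complex.eq_ofReal_of_mul_eq (hsq n p hp).1 (hsq n p hp).2 hi (hcs n)
    rw [this, Complex.ofReal_re]
  have hlreal : ∀ n, ∀ p q : ℝ[X], P n = p.map Complex.ofRealHom →
      P (n + 1) = q.map Complex.ofRealHom →
      0 ≤ (lam (n + 2)).re ∧ lam (n + 2) = ((lam (n + 2)).re : ℂ) := by
    intro n p q hp hq
    have := Complex.eq_ofReal_of_mul_eq (hsq n p hp).1 (hsq n p hp).2 (hsq _ q hq).2 (hlam n)
    rw [this, Complex.ofReal_re]
    exact ⟨(div_pos (hsq _ q hq).1 (hsq n p hp).1).le, rfl⟩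
  have hreal : ∀ n, (∃ p : ℝ[X], P n = p.map Complex.ofRealHom) ∧
      ∃ p : ℝ[X], P (n + 1) = p.map Complex.ofRealHom := by
    intro n
    induction n with
    | zero =>
      have hp0 : P 0 = (1 : ℝ[X]).map Complex.ofRealHom := by simp [h0]
      refine ⟨⟨1, hp0⟩, X - C (cs 1).re, ?_⟩
      rw [zero_add, h1, hcreal 0 1 hp0]
      simp
    | succ n ih =>
      obtain ⟨⟨p, hp⟩, q, hq⟩ := ih
      refine ⟨⟨q, hq⟩, (X - C (cs (n + 2)).re) * q - C (lam (n + 2)).re * p, ?_⟩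
      rw [h2, (hlreal n p q hp hq).2, hcreal (n + 1) q hq, hp, hq]
      simp
  exact ⟨fun n => (hreal n).1, fun n => hcreal n _ (hreal n).1.choose_spec,
    fun n => hlreal n _ _ (hreal n).1.choose_spec (hreal n).2.choose_spec⟩

/-! ### The Geronimus transformation -/

theorem degree_dividedDifference_lt {q : ℂ[X]} {n : ℕ} (hq : q.degree < ((n + 1 : ℕ) : WithBot ℕ))
    (κ : ℂ) : (dividedDifference q κ).degree < n := by
  have h : ((X - C κ) * dividedDifference q κ).degree < ((n + 1 : ℕ) : WithBot ℕ) := by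
    rw [mul_dividedDifference]
    refine (degree_sub_le _ _).trans_lt (max_lt hq (degree_C_le.trans_lt ?_))
    exact_mod_cast n.succ_pos
  by_cases h0 : dividedDifference q κ = 0
  · rw [h0, degree_zero]
    exact WithBot.bot_lt_coe n
  · rw [degree_mul, degree_X_sub_C, degree_eq_natDegree h0] at h
    rw [degree_eq_natDegree h0]
    norm_cast at h ⊢
    omega

section
variable {L : ℂ[X] →ₗ[ℂ] ℂ} {P : ℕ → ℂ[X]} {κ s : ℂ}

theorem geronimusFunctional_eq_mul_geronimusR (hs : s ≠ 0) (n : ℕ) :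
    geronimusFunctional L κ s (P n) = s * geronimusR L P s n κ := by
  change L (dividedDifference (P n) κ) + s * (P n).eval κ =
    s * ((P n).eval κ + 1 / s * L (dividedDifference (P n) κ))
  field_simp
  ring

theorem geronimusFunctional_geronimusPoly_succ (hs : s ≠ 0)
    (hR : ∀ n, geronimusR L P s n κ ≠ 0) (n : ℕ) :
    geronimusFunctional L κ s (geronimusPoly L P κ s (n + 1)) = 0 := by
  rw [geronimusPoly, map_add, LinearMap.map_C_mul, geronimusFunctional_eq_mul_geronimusR hs,
    geronimusFunctional_eq_mul_geronimusR hs]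
  have := hR n
  field_simp
  ring

/-- Dividing `q` by `z - κ` reduces the transformed functional to `L`, since the remainder, a
constant, is annihilated. -/
theorem geronimusFunctional_geronimusPoly_succ_mul (hs : s ≠ 0)
    (hR : ∀ n, geronimusR L P s n κ ≠ 0) (n : ℕ) (q : ℂ[X]) :
    geronimusFunctional L κ s (geronimusPoly L P κ s (n + 1) * q) =
      L (geronimusPoly L P κ s (n + 1) * dividedDifference q κ) := by
  have hq : q = C (q.eval κ) + (X - C κ) * dividedDifference q κ := by
    rw [mul_dividedDifference]
    ring
  conv_lhs => rw [hq]
  rw [mul_add, mul_comm _ (C _), mul_left_comm, map_add, LinearMap.map_C_mul,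
    geronimusFunctional_geronimusPoly_succ hs hR, geronimusFunctional_mul, mul_zero, zero_add]

theorem IsMonicOPS.degree_eq (hP : IsMonicOPS L P) (n : ℕ) : (P n).degree = n := by
  rw [degree_eq_natDegree (hP.monic n).ne_zero, hP.natDegree_eq]

theorem IsMonicOPS.degree_C_mul_lt (hP : IsMonicOPS L P) (n : ℕ) (x : ℂ) :
    (C x * P n).degree < (P (n + 1)).degree := by
  refine (degree_mul_le _ _).trans_lt ?_
  rw [hP.degree_eq, hP.degree_eq]
  refine (add_le_add_left degree_C_le _).trans_lt ?_
  rw [zero_add]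
  exact_mod_cast n.lt_succ_self

theorem monic_geronimusPoly (hP : IsMonicOPS L P) (n : ℕ) : (geronimusPoly L P κ s n).Monic := by
  rcases n with _ | n
  · exact hP.monic 0
  · exact (hP.monic _).add_of_left (hP.degree_C_mul_lt n _)

theorem natDegree_geronimusPoly (hP : IsMonicOPS L P) (n : ℕ) :
    (geronimusPoly L P κ s n).natDegree = n := by
  rcases n with _ | n
  · exact hP.natDegree_eq 0
  · rw [geronimusPoly, natDegree_add_eq_left_of_degree_lt (hP.degree_C_mul_lt n _), hP.natDegree_eq]

theorem isMonicOPS_geronimus (hP : IsMonicOPS L P) (hs : s ≠ 0)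
    (hR : ∀ n, geronimusR L P s n κ ≠ 0) :
    IsMonicOPS (geronimusFunctional L κ s) (geronimusPoly L P κ s) := by
  have hdeg : ∀ n, (geronimusPoly L P κ s n).degree = n := fun n => by
    rw [degree_eq_natDegree (monic_geronimusPoly hP n).ne_zero, natDegree_geronimusPoly hP]
  have hlt : ∀ n m, m < n → geronimusFunctional L κ s
      (geronimusPoly L P κ s n * geronimusPoly L P κ s m) = 0 := by
    intro n m hmn
    obtain ⟨n, rfl⟩ : ∃ k, n = k + 1 := ⟨n - 1, by omega⟩
    rw [geronimusFunctional_geronimusPoly_succ_mul hs hR]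
    have hd : (dividedDifference (geronimusPoly L P κ s m) κ).degree < n :=
      degree_dividedDifference_lt (by rw [hdeg]; exact_mod_cast hmn) κ
    rw [geronimusPoly, add_mul, map_add, mul_assoc, LinearMap.map_C_mul, hP.apply_mul_eq_zero hd,
      hP.apply_mul_eq_zero (hd.trans (by exact_mod_cast n.lt_succ_self)), mul_zero, add_zero]
  refine ⟨monic_geronimusPoly hP, natDegree_geronimusPoly hP, fun n m hnm => ?_, fun n => ?_⟩
  · rcases hnm.lt_or_gt with h | h
    · rw [mul_comm]
      exact hlt m n h
    · exact hlt n m h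
  · rcases n with _ | n
    · have h0 : P 0 = 1 := (hP.monic 0).natDegree_eq_zero.1 (hP.natDegree_eq 0)
      rw [geronimusPoly, h0, one_pow, geronimusFunctional_one]
      exact hs
    · rw [sq, geronimusFunctional_geronimusPoly_succ_mul hs hR]
      set D := dividedDifference (geronimusPoly L P κ s (n + 1)) κ with hD
      have hmul := mul_dividedDifference (geronimusPoly L P κ s (n + 1)) κ
      have hDm : D.Monic := by
        refine (monic_X_sub_C κ).of_mul_monic_left ?_
        rw [hmul]
        refine (monic_geronimusPoly hP _).sub_of_left (degree_C_le.trans_lt ?_)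
        rw [hdeg]
        exact_mod_cast n.succ_pos
      have hDlt : D.degree < ((n + 1 : ℕ) : WithBot ℕ) :=
        degree_dividedDifference_lt (by rw [hdeg]; exact_mod_cast (n + 1).lt_succ_self) κ
      have hDd : D.degree = n := by
        have h := congrArg degree hmul
        rw [degree_sub_eq_left_of_degree_lt (degree_C_le.trans_lt
          (by rw [hdeg]; exact_mod_cast n.succ_pos)), hdeg, ← hD, degree_mul, degree_X_sub_C,
          degree_eq_natDegree hDm.ne_zero] at h
        rw [degree_eq_natDegree hDm.ne_zero]
        norm_cast at h ⊢
        omega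
      have hlow : (D - P n).degree < n := by
        rw [← hDd]
        refine degree_sub_lt_left ?_ hDm.ne_zero ?_
        · rw [hDd, hP.degree_eq]
        · rw [hDm, hP.monic]
      have hPD : L (P n * D) = L (P n ^ 2) := by
        have := hP.apply_mul_eq_zero hlow
        rw [mul_sub, map_sub, sub_eq_zero] at this
        rw [this, sq]
      rw [geronimusPoly, add_mul, map_add, mul_assoc, LinearMap.map_C_mul,
        hP.apply_mul_eq_zero hDlt, hPD, zero_add]
      exact mul_ne_zero (neg_ne_zero.2 (div_ne_zero (hR _) (hR _))) (hP.sq_ne_zero n)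
end

/-! ### The recurrence at non-real points -/

theorem eval_succ_eq_recurrenceRatio_mul {P : ℕ → ℂ[X]} {b lam : ℕ → ℝ} (hlam : ∀ n, 0 ≤ lam n)
    (h0 : P 0 = 1) (h1 : P 1 = X - C (b 0 : ℂ))
    (h2 : ∀ n, P (n + 2) = (X - C (b (n + 1) : ℂ)) * P (n + 1) - C (lam (n + 1) : ℂ) * P n)
    {z : ℂ} (hz : z.im ≠ 0) (n : ℕ) :
    (P (n + 1)).eval z = recurrenceRatio b lam n z * (P n).eval z := by
  induction n with
  | zero => simp [h0, h1, recurrenceRatio]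
  | succ n ih =>
    have hr := recurrenceRatio_ne_zero (b := b) hlam hz n
    have hp : (P n).eval z = (P (n + 1)).eval z / recurrenceRatio b lam n z := by
      rw [ih, mul_div_cancel_left₀ _ hr]
    simp only [h2, eval_sub, eval_mul, eval_X, eval_C, recurrenceRatio]
    rw [hp]
    field_simp

/-- The `Rₙ` satisfy the recurrence of the `Pₙ`, except that its first coefficient `c₁` becomes
`c₁ - L[1] / s`. -/
theorem geronimusR_succ {L : ℂ[X] →ₗ[ℂ] ℂ} {P : ℕ → ℂ[X]} (hP : IsMonicOPS L P)
    {b lam : ℕ → ℝ} (hlam : ∀ n, 0 ≤ lam n)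
    (h0 : P 0 = 1) (h1 : P 1 = X - C (b 0 : ℂ))
    (h2 : ∀ n, P (n + 2) = (X - C (b (n + 1) : ℂ)) * P (n + 1) - C (lam (n + 1) : ℂ) * P n)
    {κ s : ℂ} (hκ : κ.im ≠ 0) (hs : s ≠ 0) {β : ℝ} (hβ : (β : ℂ) = b 0 - L 1 / s) (n : ℕ) :
    geronimusR L P s (n + 1) κ =
      recurrenceRatio (Function.update b 0 β) lam n κ * geronimusR L P s n κ := by
  have hR : ∀ n, geronimusFunctional L κ s (P n) = s * geronimusR L P s n κ :=
    geronimusFunctional_eq_mul_geronimusR hs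
  apply mul_left_cancel₀ hs
  induction n with
  | zero =>
    rw [mul_left_comm, ← hR, ← hR, zero_add, h1, h0, geronimusFunctional_one,
      show X - C (b 0 : ℂ) = (X - C κ) * 1 + C (κ - b 0) * 1 by rw [C_sub]; ring, map_add,
      LinearMap.map_C_mul, geronimusFunctional_mul, geronimusFunctional_one, recurrenceRatio,
      Function.update_self, hβ]
    field_simp
    ring
  | succ n ih =>
    have hr := recurrenceRatio_ne_zero (b := Function.update b 0 β) hlam hκ n
    have hRn : geronimusR L P s n κ =
        geronimusR L P s (n + 1) κ / recurrenceRatio (Function.update b 0 β) lam n κ := by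
      rw [mul_left_cancel₀ hs ih, mul_div_cancel_left₀ _ hr]
    have hL0 : L (P (n + 1)) = 0 := by
      simpa [h0] using hP.orthogonal (n + 1) 0 (by omega)
    rw [← hR, h2, show (X - C (b (n + 1) : ℂ)) * P (n + 1) - C (lam (n + 1) : ℂ) * P n =
      (X - C κ) * P (n + 1) + C (κ - b (n + 1)) * P (n + 1) - C (lam (n + 1) : ℂ) * P n by
        rw [C_sub]; ring, map_sub, map_add, LinearMap.map_C_mul, LinearMap.map_C_mul,
      geronimusFunctional_mul, hL0, hR, hR, hRn, recurrenceRatio,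
      Function.update_of_ne n.succ_ne_zero]
    field_simp
    ring

theorem mainTheorem9 (L : ℂ[X] →ₗ[ℂ] ℂ) (hL : IsPositiveDefinite L)
    (P : ℕ → ℂ[X]) (hP : IsMonicOPS L P) (a c : ℝ) (hN : InNevaiClass P a c)
    (κ : ℂ) (hκ : κ.im ≠ 0) (s : ℝ) (hs : s ≠ 0) :
    -- the Geronimus transformation is well defined
    (∀ n, geronimusR L P s n κ ≠ 0) ∧
    IsMonicOPS (geronimusFunctional L κ s) (geronimusPoly L P κ s) ∧
    -- zeros, counted with multiplicity
    ∃ ξ : ℕ → ℂ,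
      (∀ n, 1 ≤ n → (geronimusPoly L P κ s n).IsRoot (ξ n)) ∧
      Tendsto ξ atTop (𝓝 κ) ∧
      ∀ ε : ℝ, 0 < ε → ∃ N : ℕ, ∀ n, N ≤ n →
        ∀ w ∈ (geronimusPoly L P κ s n).roots.erase (ξ n), |w.im| < ε := by
  obtain ⟨ha, cs, lamc, h0, h1, h2, hcs, hlamc⟩ := hN
  have h2' : ∀ n, P (n + 2) = (X - C (cs (n + 2))) * P (n + 1) - C (lamc (n + 2)) * P n :=
    fun n => h2 (n + 2) (by omega)
  obtain ⟨hreal, hcreal, hlreal⟩ := hP.real_recurrence hL h0 h1 h2'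
  have hs' : (s : ℂ) ≠ 0 := by exact_mod_cast hs
  set b : ℕ → ℝ := fun n => (cs (n + 1)).re with hb
  -- The absolute value matters for `lam 0` alone, which plays no role in the recurrence.
  set lam : ℕ → ℝ := fun n => |(lamc (n + 1)).re| with hlam
  have hlam0 : ∀ n, 0 ≤ lam n := fun n => abs_nonneg _
  have h1b : P 1 = X - C (b 0 : ℂ) := by
    rw [h1]
    exact congrArg (fun x => X - C x) (hcreal 0)
  have h2b : ∀ n, P (n + 2) =
      (X - C (b (n + 1) : ℂ)) * P (n + 1) - C (lam (n + 1) : ℂ) * P n := by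
    intro n
    have e1 : cs (n + 2) = (b (n + 1) : ℂ) := hcreal (n + 1)
    have e2 : lamc (n + 2) = (lam (n + 1) : ℂ) := by
      rw [(hlreal n).2]
      exact congrArg Complex.ofReal (abs_of_nonneg (hlreal n).1).symm
    rw [h2' n, e1, e2]
  have hblim : Tendsto b atTop (𝓝 c) :=
    ((Complex.continuous_re.tendsto _).comp hcs).comp (tendsto_add_atTop_nat 1)
  have hllim : Tendsto lam atTop (𝓝 a) := by
    have := (((Complex.continuous_re.tendsto _).comp hlamc).comp (tendsto_add_atTop_nat 1)).abs
    rwa [Complex.ofReal_re, abs_of_nonneg ha] at this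
  obtain ⟨β, hβ⟩ : ∃ β : ℝ, (β : ℂ) = b 0 - L 1 / s := by
    have him : (L 1).im = 0 := by simpa using hL.im_map 1
    refine ⟨b 0 - (L 1).re / s, ?_⟩
    rw [show L 1 = ((L 1).re : ℂ) from Complex.ext rfl (by simpa using him)]
    push_cast
    simp
  have hRrec := geronimusR_succ hP hlam0 h0 h1b h2b hκ hs' hβ
  have hb'lim : Tendsto (Function.update b 0 β) atTop (𝓝 c) := by
    refine hblim.congr' ?_
    filter_upwards [eventually_ne_atTop 0] with n hn
    rw [Function.update_of_ne hn]
  have hR : ∀ n, geronimusR L P s n κ ≠ 0 := by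
    intro n
    induction n with
    | zero =>
      intro h
      have := geronimusFunctional_eq_mul_geronimusR (L := L) (P := P) (κ := κ) hs' 0
      rw [h, h0, geronimusFunctional_one, mul_zero] at this
      exact hs' this
    | succ n ih =>
      rw [hRrec]
      exact mul_ne_zero (recurrenceRatio_ne_zero hlam0 hκ n) ih
  refine ⟨hR, isMonicOPS_geronimus hP hs' hR, ?_⟩
  obtain ⟨ξ, hξ, hξlim, him⟩ := exists_tendsto_root hlam0 hblim hb'lim hllim ha hP.monic
    hP.natDegree_eq
    (fun n => by
      obtain ⟨p, hp⟩ := hreal n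
      rw [hp, Polynomial.map_map]
      congr 1
      ext x
      simp)
    (fun n z hz => eval_succ_eq_recurrenceRatio_mul hlam0 h0 h1b h2b hz n) hκ
    (G := fun n => geronimusPoly L P κ s (n + 1))
    (fun n => natDegree_geronimusPoly hP (n + 1))
    (fun n => by
      rw [geronimusPoly, hRrec, mul_div_cancel_right₀ _ (hR n), C_neg, neg_mul, sub_eq_add_neg])
  refine ⟨fun n => ξ (n - 1), fun n hn => ?_, ?_, fun ε hε => ?_⟩
  · obtain ⟨n, rfl⟩ : ∃ k, n = k + 1 := ⟨n - 1, by omega⟩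
    exact hξ n
  · exact (tendsto_add_atTop_iff_nat 1).1 (by simpa using hξlim)
  · obtain ⟨N, hN⟩ := eventually_atTop.1 (him ε hε)
    refine ⟨N + 1, fun n hn => ?_⟩
    obtain ⟨n, rfl⟩ : ∃ k, n = k + 1 := ⟨n - 1, by omega⟩
    exact hN n (by omega)
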